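/- For $n\ge 1$ let $B_n$ be the Artin braid group on $n$ strands, with generators $\sigma_1,\dots,\sigma_{n-1}$ and relations $\sigma_i\sigma_{i+1}\sigma_i=\sigma_{i+1}\sigma_i\sigma_{i+1}$ and $\sigma_i\sigma_j=\sigma_j\sigma_i$ for $|i-j|\ge 2$. Let $P_n$ be the pure braid group, i.e. the kernel of the homomorphism $B_n\to\mathfrak S_n$ with $\sigma_i\mapsto(i\ \,i+1)$, and let $(P_n,P_n)$ be its commutator subgroup, which is normal in $B_n$. A Frobenius group is a group $G$ with a subgroup $H$, $1\ne H\ne G$, such that $H\cap gHg^{-1}=1$ for all $g\in G\setminus H$. Let $p$ be a prime number with $p\equiv 3\pmod 4$. Then the group $B_p/(P_p,P_p)$ contains a subgroup $G$ of order $p(p-1)/2$ which, if $p>3$, is a Frobenius group and non-abelian. (For $p=3$, $G$ is a group of order $3$, which is a Frobenius group only in the degenerate sense in which $H=1$ is allowed.) In particular (case $p=7$), the group $B_7/(P_7,P_7)$ contains a non-abelian subgroup of order $21$. -/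

import Mathlib

/-- The defining relators of the Artin braid group on `n` strands, in the free group on
`σ₀, …, σₙ₋₂`: the braid relations `σᵢ σᵢ₊₁ σᵢ = σᵢ₊₁ σᵢ σᵢ₊₁`, and the commutation relations
`σᵢ σⱼ = σⱼ σᵢ` for `i + 2 ≤ j`. -/
inductive IsBraidRelator (n : ℕ) : FreeGroup (Fin (n - 1)) → Prop
  | braid (i j : Fin (n - 1)) (hij : (i : ℕ) + 1 = j) :
      IsBraidRelator n
        ((FreeGroup.of i * FreeGroup.of j * FreeGroup.of i) *
          (FreeGroup.of j * FreeGroup.of i * FreeGroup.of j)⁻¹)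
  | comm (i j : Fin (n - 1)) (hij : (i : ℕ) + 2 ≤ j) :
      IsBraidRelator n
        ((FreeGroup.of i * FreeGroup.of j) * (FreeGroup.of j * FreeGroup.of i)⁻¹)

/-- The Artin braid group `Bₙ` on `n` strands. -/
abbrev BraidGroup (n : ℕ) : Type := PresentedGroup {r | IsBraidRelator n r}

/-- The adjacent transposition `(i, i + 1)` of `{0, …, n - 1}`. -/
def adjacentSwap (n : ℕ) (i : Fin (n - 1)) : Equiv.Perm (Fin n) :=
  Equiv.swap ⟨i, by omega⟩ ⟨i + 1, by omega⟩

theorem adjacentSwap_relator (n : ℕ) (r : FreeGroup (Fin (n - 1))) (hr : IsBraidRelator n r) :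
    FreeGroup.lift (adjacentSwap n) r = 1 := by
  cases hr with
  | braid i j hij =>
    simp only [map_mul, map_inv, FreeGroup.lift_apply_of]
    rw [mul_inv_eq_one]
    obtain ⟨i, hi⟩ := i
    obtain ⟨j, hj⟩ := j
    obtain rfl : i + 1 = j := hij
    simp only [adjacentSwap]
    rw [Equiv.swap_comm (⟨i, _⟩ : Fin n),
      Equiv.swap_comm (⟨i + 1, _⟩ : Fin n) ⟨i + 1 + 1, _⟩,
      Equiv.swap_mul_swap_mul_swap (by grind) (by grind),
      Equiv.swap_comm (⟨i + 1, _⟩ : Fin n) ⟨i, _⟩,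
      Equiv.swap_comm (⟨i + 1 + 1, _⟩ : Fin n) ⟨i + 1, _⟩,
      Equiv.swap_mul_swap_mul_swap (by grind) (by grind)]
    exact Equiv.swap_comm _ _
  | comm i j hij =>
    simp only [map_mul, map_inv, FreeGroup.lift_apply_of]
    rw [mul_inv_eq_one]
    apply Equiv.Perm.Disjoint.commute
    apply Equiv.Perm.disjoint_swap_swap
    simp [Fin.ext_iff]
    omega

/-- The natural projection `Bₙ → 𝔖ₙ`, sending `σᵢ` to the transposition `(i, i + 1)`. -/
def BraidGroup.toPerm (n : ℕ) : BraidGroup n →* Equiv.Perm (Fin n) :=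
  PresentedGroup.toGroup (f := adjacentSwap n) (fun r hr => adjacentSwap_relator n r hr)

/-- The pure braid group `Pₙ`, the kernel of `Bₙ → 𝔖ₙ`. -/
abbrev PureBraidGroup (n : ℕ) : Subgroup (BraidGroup n) := (BraidGroup.toPerm n).ker

/-- The quotient `Bₙ / (Pₙ, Pₙ)` of the braid group by the commutator subgroup of the pure
braid group. -/
abbrev BraidModCommutator (n : ℕ) : Type :=
  BraidGroup n ⧸ ⁅PureBraidGroup n, PureBraidGroup n⁆

/-- A Frobenius group: a group `G` with a subgroup `H`, neither trivial nor all of `G`, such that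
`H ∩ g⁻¹ H g = 1` for every `g ∉ H`. -/
def IsFrobeniusGroup (G : Type*) [Group G] : Prop :=
  ∃ H : Subgroup G, H ≠ ⊥ ∧ H ≠ ⊤ ∧
    ∀ g : G, g ∉ H → ∀ x : G, x ∈ H → g * x * g⁻¹ ∈ H → x = 1

/-! Count the signed crossings of each unordered pair of strands, and remember the permutation. This
maps `Bₙ` to the semidirect product of the integer functions on pairs with `𝔖ₙ` (`crossing`), and
pure braids land in the abelian factor, so `(Pₙ, Pₙ)` dies. The induced map is injective
(`crossingBar_injective`): `Pₙ` is the normal closure of the `σᵢ²`, and modulo commutators a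
conjugate of `σᵢ²` depends only on the pair it twists. Hence the twists generate the abelianization,
and they go to twice the basis vectors of the off-diagonal pairs.

The image is thus an extension of `𝔖ₙ` by the even functions vanishing on the diagonal. Over a
subgroup `K` of odd order it splits by averaging. Let `u g` be the crossing function of any lift of
`g`; modulo 2 it is a cocycle. With `c = ∑ u g` over `K`, `c - h • c ≡ |K| u h ≡ u h (mod 2)`, so
conjugating the standard copy of `K` by `c` puts it inside the image
(`exists_mulEquiv_of_odd_card`).

Take for `K` the maps `x ↦ a x + b` of `ℤ/p` with `a` a nonzero square. Its order `p (p - 1) / 2` is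
odd exactly because `p ≡ 3 (mod 4)`. -/

/-! ### Coxeter sequences of type A -/

/-- The descending product `s k * s (k - 1) * ⋯ * s (k - d + 1)` of `d` factors. -/
def descProd {Γ : Type*} [Group Γ] (s : ℕ → Γ) (k : ℕ) : ℕ → Γ
  | 0 => 1
  | d + 1 => descProd s k d * s (k - d)

/-- The Coxeter relations of type `A` for a sequence of `m` elements. -/
structure IsCoxeterSequence {Γ : Type*} [Group Γ] (m : ℕ) (s : ℕ → Γ) : Prop where
  sq : ∀ i < m, s i * s i = 1
  braid : ∀ i, i + 1 < m → s i * s (i + 1) * s i = s (i + 1) * s i * s (i + 1)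
  comm : ∀ i j, i + 2 ≤ j → j < m → s i * s j = s j * s i

namespace IsCoxeterSequence

variable {Γ : Type*} [Group Γ] {m : ℕ} {s : ℕ → Γ}

/-- Every factor has index at least `i + 2`. -/
theorem descProd_mul_of_lt (hs : IsCoxeterSequence m s) {k : ℕ} (hk : k < m) {i : ℕ} :
    ∀ d, i + d < k → descProd s k d * s i = s i * descProd s k d := by
  intro d
  induction d with
  | zero => intro _; simp [descProd]
  | succ d ih =>
    intro h
    rw [descProd, mul_assoc, ← hs.comm i (k - d) (by omega) (by omega), ← mul_assoc,
      ih (by omega), mul_assoc]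

/-- The factors `s (i + 1) * s i` occur in the product; one braid relation there lowers the index,
and all other factors commute past. -/
theorem descProd_mul_of_gt (hs : IsCoxeterSequence m s) {k : ℕ} (hk : k < m) {i : ℕ}
    (hi : i + 1 ≤ k) :
    ∀ d, d ≤ k + 1 → k < i + d → descProd s k d * s (i + 1) = s i * descProd s k d := by
  intro d
  induction d with
  | zero => intro _ _; omega
  | succ d ih =>
    intro hd h
    rcases Nat.lt_or_ge k (i + d) with h' | h'
    · rw [descProd, mul_assoc, hs.comm (k - d) (i + 1) (by omega) (by omega), ← mul_assoc,
        ih (by omega) h', mul_assoc]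
    · obtain ⟨e, rfl⟩ : ∃ e, d = e + 1 := ⟨d - 1, by omega⟩
      have h1 : k - (e + 1) = i := by omega
      have h2 : k - e = i + 1 := by omega
      rw [descProd, descProd, h1, h2, mul_assoc, mul_assoc, ← mul_assoc (s (i + 1)),
        ← hs.braid i (by omega), ← mul_assoc, ← mul_assoc,
        hs.descProd_mul_of_lt hk e (by omega)]
      simp only [mul_assoc]

/-- Coset enumeration: right multiplication by a generator permutes the cosets of the descending
products, by lengthening, shortening or keeping the product. -/
theorem exists_eq_mul_descProd (hs : IsCoxeterSequence m s) {k : ℕ} (hk : k < m) {w : Γ}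
    (hw : w ∈ Subgroup.closure (s '' Set.Iio (k + 1))) :
    ∃ h ∈ Subgroup.closure (s '' Set.Iio k), ∃ d ≤ k + 1, w = h * descProd s k d := by
  have key : ∀ i ≤ k, ∀ d ≤ k + 1, ∃ h ∈ Subgroup.closure (s '' Set.Iio k), ∃ e ≤ k + 1,
      descProd s k d * s i = h * descProd s k e := by
    intro i hi d hd
    have mem : ∀ j < k, s j ∈ Subgroup.closure (s '' Set.Iio k) := fun j hj =>
      Subgroup.subset_closure ⟨j, hj, rfl⟩
    rcases Nat.lt_trichotomy (i + d) k with h | h | h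
    · exact ⟨s i, mem i (by omega), d, hd, hs.descProd_mul_of_lt hk d h⟩
    · refine ⟨1, one_mem _, d + 1, by omega, ?_⟩
      rw [descProd, one_mul, show k - d = i by omega]
    · obtain ⟨e, rfl⟩ : ∃ e, d = e + 1 := ⟨d - 1, by omega⟩
      rcases Nat.lt_or_ge k (i + e) with h' | h'
      · obtain ⟨j, rfl⟩ : ∃ j, i = j + 1 := ⟨i - 1, by omega⟩
        exact ⟨s j, mem j (by omega), e + 1, hd, hs.descProd_mul_of_gt hk hi _ hd (by omega)⟩
      · refine ⟨1, one_mem _, e, by omega, ?_⟩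
        rw [descProd, one_mul, show k - e = i by omega, mul_assoc, hs.sq i (by omega), mul_one]
  have step : ∀ w, (∃ h ∈ Subgroup.closure (s '' Set.Iio k), ∃ d ≤ k + 1,
      w = h * descProd s k d) → ∀ i ≤ k, ∃ h ∈ Subgroup.closure (s '' Set.Iio k), ∃ d ≤ k + 1,
      w * s i = h * descProd s k d := by
    rintro _ ⟨h, hh, d, hd, rfl⟩ i hi
    obtain ⟨h', hh', e, he, hmul⟩ := key i hi d hd
    exact ⟨h * h', mul_mem hh hh', e, he, by rw [mul_assoc, hmul, mul_assoc]⟩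
  induction hw using Subgroup.closure_induction_right with
  | one => exact ⟨1, one_mem _, 0, by omega, by simp [descProd]⟩
  | mul_right x _ y hy ih =>
    obtain ⟨i, hi, rfl⟩ := hy
    exact step x ih i (Nat.lt_succ_iff.mp hi)
  | mul_inv_cancel x _ y hy ih =>
    obtain ⟨i, hi, rfl⟩ := hy
    have hi : i ≤ k := Nat.lt_succ_iff.mp hi
    rw [inv_eq_of_mul_eq_one_left (hs.sq i (by omega))]
    exact step x ih i hi

/-- A group generated by a Coxeter sequence of type `A` acts faithfully if the generators act as
adjacent transpositions. -/
theorem eq_one_of_map_eq_one {α : Type*} [DecidableEq α] (hs : IsCoxeterSequence m s)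
    (π : Γ →* Equiv.Perm α) (pt : ℕ → α) (hpt : Set.InjOn pt (Set.Iic m))
    (hπ : ∀ i < m, π (s i) = Equiv.swap (pt i) (pt (i + 1))) :
    ∀ k ≤ m, ∀ w ∈ Subgroup.closure (s '' Set.Iio k), π w = 1 → w = 1 := by
  intro k
  have hne : ∀ i ≤ m, ∀ j ≤ m, i ≠ j → pt i ≠ pt j := fun i hi j hj hij h => hij (hpt hi hj h)
  induction k with
  | zero =>
    intro _ w hw _
    simpa using hw
  | succ k ih =>
    intro hk w hw hw1
    obtain ⟨h, hh, d, hd, rfl⟩ := hs.exists_eq_mul_descProd (by omega) hw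
    -- `h` fixes the last point, whereas the descending product of length `d` carries the point `d`
    -- places earlier to it; a trivial action forces `d = 0`.
    have fix : π h (pt (k + 1)) = pt (k + 1) := by
      have : Subgroup.closure (s '' Set.Iio k) ≤
          (MulAction.stabilizer (Equiv.Perm α) (pt (k + 1))).comap π := by
        rw [Subgroup.closure_le]
        rintro _ ⟨i, hi, rfl⟩
        have hi : i < k := hi
        simp only [Subgroup.coe_comap, Set.mem_preimage, SetLike.mem_coe,
          MulAction.mem_stabilizer_iff, Equiv.Perm.smul_def]
        rw [hπ i (by omega)]
        exact Equiv.swap_apply_of_ne_of_ne (hne _ (by omega) _ (by omega) (by omega))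
          (hne _ (by omega) _ (by omega) (by omega))
      exact this hh
    have move : ∀ e ≤ k + 1, π (descProd s k e) (pt (k + 1 - e)) = pt (k + 1) := by
      intro e
      induction e with
      | zero => simp [descProd]
      | succ e ihe =>
        intro he
        rw [descProd, map_mul, Equiv.Perm.mul_apply, hπ (k - e) (by omega),
          show k + 1 - (e + 1) = k - e by omega, Equiv.swap_apply_left,
          show k - e + 1 = k + 1 - e by omega, ihe (by omega)]
    have : pt (k + 1) = pt (k + 1 - d) := by
      conv_rhs => rw [← Equiv.Perm.one_apply (pt (k + 1 - d)), ← hw1, map_mul,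
        Equiv.Perm.mul_apply, move d hd, fix]
    have hd0 : d = 0 := by
      by_contra hd0
      exact hne _ hk _ (by omega) (by omega) this
    subst hd0
    simp only [descProd, mul_one] at hw1 ⊢
    exact ih (by omega) h hh hw1

end IsCoxeterSequence

/-! ### Generation by adjacent transpositions -/

open Equiv

/-- The permutations fixing the first `r` points are generated by the adjacent transpositions of
the other points. -/
theorem mem_closure_adjacentSwap (n r : ℕ) (w : Perm (Fin n)) (hw : ∀ i : Fin n, i < r → w i = i) :
    w ∈ Subgroup.closure (adjacentSwap n '' {j | r ≤ (j : ℕ)}) := by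
  obtain ⟨d, hd⟩ : ∃ d, n ≤ r + d := ⟨n, by omega⟩
  induction d generalizing r w with
  | zero =>
    have : w = 1 := Equiv.ext fun i => hw i (by omega)
    exact this ▸ one_mem _
  | succ d ih =>
    by_cases hr : n ≤ r
    · exact ih r w hw (by omega)
    · push Not at hr
      obtain ⟨a, ha⟩ : ∃ a : Fin n, (a : ℕ) = r := ⟨⟨r, hr⟩, rfl⟩
      have hle : r ≤ (w a : ℕ) := by
        by_contra h
        have h2 : w a = a := w.injective (hw _ (not_le.mp h))
        rw [h2, ha] at h
        exact h le_rfl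
      obtain ⟨t, ht⟩ := Nat.exists_eq_add_of_le hle
      clear hle
      -- `t` is the distance of `w a` from `a`. Composing with an adjacent swap lowers it by one; at
      -- `t = 0` one more point is fixed.
      induction t generalizing w with
      | zero =>
        have hsub : {j : Fin (n - 1) | r + 1 ≤ (j : ℕ)} ⊆ {j | r ≤ (j : ℕ)} :=
          fun j hj => Nat.le_of_succ_le hj
        have hmono := Subgroup.closure_mono (Set.image_mono (f := adjacentSwap n) hsub)
        refine hmono (ih (r + 1) w (fun i hi => ?_) (by omega))
        rcases Nat.lt_or_ge i r with h | h
        · exact hw i h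
        · obtain rfl : i = a := Fin.ext (by omega)
          exact Fin.ext (ht.trans ha.symm)
      | succ t iht =>
        have hlt := (w a).isLt
        obtain ⟨j, hj⟩ : ∃ j : Fin (n - 1), (j : ℕ) = r + t := ⟨⟨r + t, by omega⟩, rfl⟩
        have hmem : adjacentSwap n j ∈ Subgroup.closure (adjacentSwap n '' {j | r ≤ (j : ℕ)}) :=
          Subgroup.subset_closure ⟨j, (by omega : r ≤ (j : ℕ)), rfl⟩
        refine (Subgroup.mul_mem_cancel_left _ hmem).mp (iht _ (fun i hi => ?_) ?_)
        · rw [Perm.mul_apply, hw i hi]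
          exact swap_apply_of_ne_of_ne (fun h => by rw [Fin.ext_iff] at h; dsimp at h; omega)
            (fun h => by rw [Fin.ext_iff] at h; dsimp at h; omega)
        · have : w a = ⟨j + 1, by omega⟩ := Fin.ext (by dsimp; omega)
          rw [Perm.mul_apply, this, adjacentSwap, swap_apply_right]
          exact hj

/-! ### The pure braid group as a normal closure -/

namespace BraidGroup

/-- The generator `σᵢ` of the braid group. -/
def gen {n : ℕ} (i : Fin (n - 1)) : BraidGroup n := PresentedGroup.of i

@[simp]
theorem toPerm_gen {n : ℕ} (i : Fin (n - 1)) : toPerm n (gen i) = adjacentSwap n i :=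
  PresentedGroup.toGroup.of _

theorem gen_braid {n : ℕ} {i j : Fin (n - 1)} (hij : (i : ℕ) + 1 = j) :
    gen i * gen j * gen i = gen j * gen i * gen j := by
  rw [← mul_inv_eq_one]
  exact PresentedGroup.one_of_mem (rels := {r | IsBraidRelator n r}) (.braid i j hij)

theorem gen_comm {n : ℕ} {i j : Fin (n - 1)} (hij : (i : ℕ) + 2 ≤ j) :
    gen i * gen j = gen j * gen i := by
  rw [← mul_inv_eq_one]
  exact PresentedGroup.one_of_mem (rels := {r | IsBraidRelator n r}) (.comm i j hij)

theorem closure_range_gen (n : ℕ) : Subgroup.closure (Set.range (gen (n := n))) = ⊤ :=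
  PresentedGroup.closure_range_of _

theorem map_toPerm_closure (n : ℕ) (J : Set (Fin (n - 1))) :
    (Subgroup.closure (gen '' J)).map (toPerm n) = Subgroup.closure (adjacentSwap n '' J) := by
  rw [MonoidHom.map_closure, Set.image_image]
  simp

theorem toPerm_surjective (n : ℕ) : Function.Surjective (toPerm n) := by
  intro w
  have := mem_closure_adjacentSwap n 0 w (fun i hi => by omega)
  rw [← map_toPerm_closure] at this
  obtain ⟨b, _, hb⟩ := this
  exact ⟨b, hb⟩

/-- The pure braid group is the normal closure of the squares of the generators. -/
theorem pureBraidGroup_eq_normalClosure (n : ℕ) :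
    PureBraidGroup n = Subgroup.normalClosure (Set.range fun i : Fin (n - 1) => gen i ^ 2) := by
  set N := Subgroup.normalClosure (Set.range fun i : Fin (n - 1) => gen i ^ 2) with hN
  have hsq : ∀ i : Fin (n - 1), gen i ^ 2 ∈ N := fun i =>
    Subgroup.subset_normalClosure ⟨i, rfl⟩
  have hle : N ≤ PureBraidGroup n := by
    refine Subgroup.normalClosure_le_normal ?_
    rintro _ ⟨i, rfl⟩
    simp [MonoidHom.mem_ker, adjacentSwap, sq]
  refine le_antisymm (fun b hb => ?_) hle
  rcases Nat.eq_zero_or_pos n with rfl | hn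
  · have : b ∈ Subgroup.closure (Set.range (gen (n := 0))) := by
      rw [closure_range_gen]; trivial
    have he : Set.range (gen (n := 0)) = ∅ := Set.range_eq_empty_iff.mpr (by
      change IsEmpty (Fin 0); infer_instance)
    rw [he, Subgroup.closure_empty, Subgroup.mem_bot] at this
    exact this ▸ one_mem _
  · let s : ℕ → BraidGroup n ⧸ N := fun i => if h : i < n - 1 then (gen ⟨i, h⟩ : BraidGroup n) else 1
    let π : BraidGroup n ⧸ N →* Perm (Fin n) := QuotientGroup.lift N (toPerm n) hle
    -- The out-of-range values of `s` and `pt` are never used; the default point needs `0 < n`.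
    let pt : ℕ → Fin n := fun i => if h : i < n then ⟨i, h⟩ else ⟨0, hn⟩
    have hs : IsCoxeterSequence (n - 1) s := by
      refine ⟨fun i hi => ?_, fun i hi => ?_, fun i j hij hj => ?_⟩
      · simp only [s, dif_pos hi]
        rw [← QuotientGroup.mk_mul, QuotientGroup.eq_one_iff, ← sq]
        exact hsq _
      · have hi' : i < n - 1 := by omega
        simp only [s, dif_pos hi, dif_pos hi', ← QuotientGroup.mk_mul]
        rw [gen_braid rfl]
      · have hi' : i < n - 1 := by omega
        simp only [s, dif_pos hj, dif_pos hi', ← QuotientGroup.mk_mul]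
        rw [gen_comm hij]
    have hpt : Set.InjOn pt (Set.Iic (n - 1)) := by
      intro i hi j hj h
      have hi : i < n := by have : i ≤ n - 1 := hi; omega
      have hj : j < n := by have : j ≤ n - 1 := hj; omega
      simpa [pt, hi, hj] using h
    have hπ : ∀ i < n - 1, π (s i) = swap (pt i) (pt (i + 1)) := by
      intro i hi
      have h1 : i < n := by omega
      have h2 : i + 1 < n := by omega
      simp only [s, pt, dif_pos hi, dif_pos h1, dif_pos h2, π]
      exact toPerm_gen _
    rw [← QuotientGroup.eq_one_iff]
    refine hs.eq_one_of_map_eq_one π pt hpt hπ (n - 1) le_rfl _ ?_ hb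
    have hmem : b ∈ Subgroup.closure (Set.range (gen (n := n))) := by
      rw [closure_range_gen]; trivial
    have hmap := Subgroup.mem_map_of_mem (QuotientGroup.mk' N) hmem
    rw [MonoidHom.map_closure] at hmap
    refine Subgroup.closure_mono ?_ hmap
    rintro _ ⟨_, ⟨i, rfl⟩, rfl⟩
    exact ⟨i, i.isLt, by simp [s]⟩

/-- All generators of the braid group are conjugate. -/
theorem exists_gen_eq_conj {n : ℕ} (hn : 0 < n - 1) (i : Fin (n - 1)) :
    ∃ b : BraidGroup n, gen i = b * gen ⟨0, hn⟩ * b⁻¹ := by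
  obtain ⟨i, hi⟩ := i
  induction i with
  | zero => exact ⟨1, by simp⟩
  | succ i ih =>
    obtain ⟨b, hb⟩ := ih (by omega)
    refine ⟨gen ⟨i, by omega⟩ * gen ⟨i + 1, hi⟩ * b, ?_⟩
    have h := gen_braid (n := n) (i := ⟨i, by omega⟩) (j := ⟨i + 1, hi⟩) rfl
    calc gen ⟨i + 1, hi⟩
        = gen ⟨i, by omega⟩ * gen ⟨i + 1, hi⟩ * gen ⟨i, by omega⟩ *
            (gen ⟨i, by omega⟩ * gen ⟨i + 1, hi⟩)⁻¹ := by
          rw [h]; group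
      _ = _ := by rw [hb]; group

end BraidGroup

/-! ### Crossing numbers -/

/-- Permutations act on unordered pairs. -/
instance Sym2.permMulAction (α : Type*) : MulAction (Perm α) (Sym2 α) where
  smul g := Sym2.map g
  one_smul z := by
    change Sym2.map (1 : Perm α) z = z
    rw [Perm.coe_one, Sym2.map_id, id]
  mul_smul g h z := by
    change Sym2.map (g * h : Perm α) z = Sym2.map g (Sym2.map h z)
    rw [Perm.coe_mul, Sym2.map_comp, Function.comp]

@[simp]
theorem Sym2.perm_smul_mk {α : Type*} (g : Perm α) (a b : α) : g • s(a, b) = s(g a, g b) := rfl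

theorem Sym2.isDiag_perm_smul {α : Type*} (g : Perm α) (z : Sym2 α) :
    (g • z).IsDiag ↔ z.IsDiag := by
  induction z with
  | h a b => simp

/-- The semidirect product of integer-valued functions on unordered pairs with the symmetric
group. -/
abbrev PairWreath (n : ℕ) : Type :=
  (Sym2 (Fin n) → Multiplicative ℤ) ⋊[mulAutArrow] Perm (Fin n)

theorem mulAutArrow_apply_apply' {G A M : Type*} [Group G] [MulAction G A] [Monoid M]
    (g : G) (F : A → M) (z : A) : mulAutArrow g F z = F (g⁻¹ • z) := rfl

theorem mulAutArrow_mulSingle {G A M : Type*} [Group G] [MulAction G A] [Monoid M] [DecidableEq A]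
    (g : G) (z : A) (a : M) :
    mulAutArrow g (Pi.mulSingle z a : A → M) = Pi.mulSingle (g • z) a := by
  ext y
  rw [mulAutArrow_apply_apply']
  by_cases h : y = g • z
  · subst h; simp
  · rw [Pi.mulSingle_eq_of_ne h, Pi.mulSingle_eq_of_ne]
    rintro rfl
    simp at h

namespace BraidGroup

/-- The unordered pair of points swapped by the generator `σᵢ`. -/
def genPair {n : ℕ} (i : Fin (n - 1)) : Sym2 (Fin n) :=
  s(⟨i, by omega⟩, ⟨i + 1, by omega⟩)

/-- The crossing contributed by `σᵢ`, together with its permutation. -/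
def genCrossing (n : ℕ) (i : Fin (n - 1)) : PairWreath n :=
  ⟨Pi.mulSingle (genPair i) (Multiplicative.ofAdd 1), adjacentSwap n i⟩

/-- Each side of the braid relation crosses each pair among three points once, in opposite orders.
For distant generators, each swap fixes the pair of the other. -/
theorem genCrossing_relator (n : ℕ) (r : FreeGroup (Fin (n - 1))) (hr : IsBraidRelator n r) :
    FreeGroup.lift (genCrossing n) r = 1 := by
  have hperm := adjacentSwap_relator n r hr
  cases hr with
  | braid i j hij =>
    simp only [map_mul, map_inv, FreeGroup.lift_apply_of] at hperm ⊢
    rw [mul_inv_eq_one] at hperm ⊢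
    refine SemidirectProduct.ext ?_ hperm
    obtain ⟨i, hi⟩ := i
    obtain ⟨j, hj⟩ := j
    obtain rfl : i + 1 = j := hij
    simp only [SemidirectProduct.mul_left, SemidirectProduct.mul_right, genCrossing,
      mulAutArrow_mulSingle]
    obtain ⟨p, hp⟩ : ∃ p : Fin n, p = ⟨i, by omega⟩ := ⟨_, rfl⟩
    obtain ⟨q, hq⟩ : ∃ p : Fin n, p = ⟨i + 1, by omega⟩ := ⟨_, rfl⟩
    obtain ⟨t, ht⟩ : ∃ p : Fin n, p = ⟨i + 1 + 1, by omega⟩ := ⟨_, rfl⟩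
    have hpq : p ≠ q := by simp [hp, hq]
    have hpt : p ≠ t := by simp [hp, ht]; omega
    have hqt : q ≠ t := by simp [hq, ht]
    simp only [genPair, adjacentSwap, ← hp, ← hq, ← ht, Sym2.perm_smul_mk, Perm.mul_apply,
      swap_apply_left, swap_apply_right, swap_apply_of_ne_of_ne hpt.symm hqt.symm,
      swap_apply_of_ne_of_ne hpq hpt]
    rw [mul_assoc, mul_comm, mul_assoc, mul_assoc]
    exact mul_left_comm _ _ _
  | comm i j hij =>
    simp only [map_mul, map_inv, FreeGroup.lift_apply_of] at hperm ⊢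
    rw [mul_inv_eq_one] at hperm ⊢
    refine SemidirectProduct.ext ?_ hperm
    obtain ⟨i, hi⟩ := i
    obtain ⟨j, hj⟩ := j
    have hij : i + 2 ≤ j := hij
    simp only [SemidirectProduct.mul_left, genCrossing, mulAutArrow_mulSingle, genPair,
      adjacentSwap, Sym2.perm_smul_mk]
    rw [swap_apply_of_ne_of_ne, swap_apply_of_ne_of_ne, swap_apply_of_ne_of_ne,
      swap_apply_of_ne_of_ne, mul_comm] <;>
    · rw [Ne, Fin.mk.injEq]
      omega

/-- The homomorphism counting the signed crossings of each pair of strands. -/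
def crossing (n : ℕ) : BraidGroup n →* PairWreath n :=
  PresentedGroup.toGroup (f := genCrossing n) (fun r hr => genCrossing_relator n r hr)

@[simp]
theorem crossing_gen {n : ℕ} (i : Fin (n - 1)) : crossing n (gen i) = genCrossing n i :=
  PresentedGroup.toGroup.of _

@[simp]
theorem crossing_right {n : ℕ} (b : BraidGroup n) : (crossing n b).right = toPerm n b := by
  have : SemidirectProduct.rightHom.comp (crossing n) = toPerm n := by
    refine PresentedGroup.ext fun i => ?_
    change (crossing n (gen i)).right = toPerm n (gen i)
    rw [crossing_gen, toPerm_gen, genCrossing]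
  exact DFunLike.congr_fun this b

/-- No strand crosses itself. The parity argument needs this, since only functions vanishing on the
diagonal come from twists. -/
theorem crossing_left_of_isDiag {n : ℕ} (b : BraidGroup n) {z : Sym2 (Fin n)} (hz : z.IsDiag) :
    (crossing n b).left z = 1 := by
  have hb : b ∈ Subgroup.closure (Set.range (gen (n := n))) := by
    rw [closure_range_gen]; trivial
  induction hb using Subgroup.closure_induction generalizing z with
  | mem x hx =>
    obtain ⟨i, rfl⟩ := hx
    rw [crossing_gen]
    refine Pi.mulSingle_eq_of_ne ?_ _
    rintro rfl
    simp [genPair] at hz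
  | one => simp
  | mul x y _ _ hx hy =>
    rw [map_mul, SemidirectProduct.mul_left, Pi.mul_apply, hx hz, mulAutArrow_apply_apply',
      hy ((Sym2.isDiag_perm_smul _ _).mpr hz), one_mul]
  | inv x _ hx =>
    rw [map_inv, SemidirectProduct.inv_left, mulAutArrow_apply_apply', Pi.inv_apply,
      hx ((Sym2.isDiag_perm_smul _ _).mpr hz), inv_one]

/-- The crossings of `b` and `b⁻¹` cancel, because the square between them is pure and acts
trivially. -/
theorem crossing_conj_gen_sq {n : ℕ} (b : BraidGroup n) (i : Fin (n - 1)) :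
    crossing n (b * gen i ^ 2 * b⁻¹) =
      SemidirectProduct.inl (Pi.mulSingle (toPerm n b • genPair i) (Multiplicative.ofAdd 2)) := by
  have hfix : adjacentSwap n i • genPair i = genPair i := by
    simp [adjacentSwap, genPair, Sym2.eq_swap]
  have hsq : crossing n (gen i ^ 2) =
      SemidirectProduct.inl (Pi.mulSingle (genPair i) (Multiplicative.ofAdd 2)) := by
    rw [map_pow, crossing_gen, sq]
    refine SemidirectProduct.ext ?_ ?_
    · rw [SemidirectProduct.mul_left, genCrossing, mulAutArrow_mulSingle, hfix, ← Pi.mulSingle_mul]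
      rfl
    · simp [genCrossing, adjacentSwap]
  rw [map_mul, map_mul, map_inv, hsq]
  refine SemidirectProduct.ext ?_ ?_
  · simp [mulAutArrow_mulSingle]
  · simp

end BraidGroup

/-! ### The abelianized pure braid group -/

namespace BraidGroup

/-- The projection `Bₙ → Bₙ / (Pₙ, Pₙ)`. -/
abbrev modComm (n : ℕ) : BraidGroup n →* BraidModCommutator n :=
  QuotientGroup.mk' ⁅PureBraidGroup n, PureBraidGroup n⁆

theorem modComm_commute {n : ℕ} {x y : BraidGroup n} (hx : x ∈ PureBraidGroup n)
    (hy : y ∈ PureBraidGroup n) : Commute (modComm n x) (modComm n y) := by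
  rw [← commutatorElement_eq_one_iff_commute, ← map_commutatorElement]
  exact (QuotientGroup.eq_one_iff _).mpr (Subgroup.commutator_mem_commutator hx hy)

theorem gen_sq_mem {n : ℕ} (i : Fin (n - 1)) : gen i ^ 2 ∈ PureBraidGroup n := by
  simp [MonoidHom.mem_ker, adjacentSwap, sq]

theorem conj_gen_sq_mem {n : ℕ} (b : BraidGroup n) (i : Fin (n - 1)) :
    b * gen i ^ 2 * b⁻¹ ∈ PureBraidGroup n :=
  Subgroup.Normal.conj_mem inferInstance _ (gen_sq_mem i) b

/-- A braid whose permutation preserves the first two points commutes with `σ₀²` modulo the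
commutator subgroup of the pure braid group. -/
theorem modComm_commute_gen_sq {n : ℕ} (hn : 0 < n - 1) {b : BraidGroup n}
    (hb : toPerm n b • genPair ⟨0, hn⟩ = genPair ⟨0, hn⟩) :
    Commute (modComm n b) (modComm n (gen ⟨0, hn⟩ ^ 2)) := by
  -- Up to a pure braid, `b` is a word in generators `σⱼ` with `2 ≤ j`, which commute with `σ₀`.
  have fixed : ∀ b : BraidGroup n, (∀ i : Fin n, (i : ℕ) < 2 → toPerm n b i = i) →
      Commute (modComm n b) (modComm n (gen ⟨0, hn⟩ ^ 2)) := by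
    intro b hb
    have hmem := mem_closure_adjacentSwap n 2 _ hb
    rw [← map_toPerm_closure] at hmem
    obtain ⟨c, hc, hcb⟩ := hmem
    have hpure : c⁻¹ * b ∈ PureBraidGroup n := by simp [MonoidHom.mem_ker, hcb]
    have hle : Subgroup.closure (gen '' {j : Fin (n - 1) | 2 ≤ (j : ℕ)}) ≤
        Subgroup.centralizer {gen ⟨0, hn⟩ ^ 2} := by
      rw [Subgroup.closure_le]
      rintro _ ⟨j, hj, rfl⟩
      have hj : 2 ≤ (j : ℕ) := hj
      rw [SetLike.mem_coe, Subgroup.mem_centralizer_singleton_iff]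
      have h : Commute (gen ⟨0, hn⟩) (gen j) := gen_comm (by simpa using hj)
      exact (h.pow_left 2).eq.symm
    have h1 : Commute c (gen ⟨0, hn⟩ ^ 2) :=
      Subgroup.mem_centralizer_singleton_iff.mp (hle hc)
    have h2 := (h1.map (modComm n)).mul_left (modComm_commute hpure (gen_sq_mem ⟨0, hn⟩))
    rwa [← map_mul, mul_inv_cancel_left] at h2
  have hσ : Commute (modComm n (gen ⟨0, hn⟩)) (modComm n (gen ⟨0, hn⟩ ^ 2)) :=
    ((Commute.refl (gen ⟨0, hn⟩)).pow_right 2).map _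
  rw [genPair, Sym2.perm_smul_mk, Sym2.eq_iff] at hb
  have two : ∀ i : Fin n, (i : ℕ) < 2 → i = ⟨0, by omega⟩ ∨ i = ⟨0 + 1, by omega⟩ := by
    rintro ⟨i, hi⟩ (h : i < 2)
    simp only [Fin.mk.injEq]
    omega
  rcases hb with ⟨h0, h1⟩ | ⟨h0, h1⟩
  · refine fixed b fun i hi => ?_
    rcases two i hi with rfl | rfl
    exacts [h0, h1]
  -- If `b` exchanges the two points, `σ₀ b` fixes both.
  · have := fixed (gen ⟨0, hn⟩ * b) fun i hi => by
      rw [map_mul, toPerm_gen, Perm.mul_apply, adjacentSwap]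
      rcases two i hi with rfl | rfl
      · exact (congrArg _ h0).trans (swap_apply_right _ _)
      · exact (congrArg _ h1).trans (swap_apply_left _ _)
    rw [map_mul] at this
    simpa using hσ.inv_left.mul_left this

theorem modComm_conj_eq {n : ℕ} (hn : 0 < n - 1) {b c : BraidGroup n}
    (h : toPerm n b • genPair ⟨0, hn⟩ = toPerm n c • genPair ⟨0, hn⟩) :
    modComm n (b * gen ⟨0, hn⟩ ^ 2 * b⁻¹) = modComm n (c * gen ⟨0, hn⟩ ^ 2 * c⁻¹) := by
  have hcomm := modComm_commute_gen_sq hn (b := c⁻¹ * b) (by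
    rw [map_mul, map_inv, mul_smul, h, inv_smul_smul])
  have h1 := hcomm.eq
  rw [map_mul, map_inv] at h1
  rw [map_mul, map_mul, map_mul, map_mul, map_inv, map_inv, mul_inv_eq_iff_eq_mul,
    mul_assoc, mul_assoc, ← h1]
  group

theorem exists_perm_smul_genPair {n : ℕ} (hn : 0 < n - 1) {z : Sym2 (Fin n)} (hz : ¬ z.IsDiag) :
    ∃ b : BraidGroup n, toPerm n b • genPair ⟨0, hn⟩ = z := by
  induction z with
  | h a c =>
    rw [Sym2.mk_isDiag_iff] at hz
    let p : Fin n := ⟨0, by omega⟩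
    let q : Fin n := ⟨0 + 1, by omega⟩
    have hpq : p ≠ q := by simp [p, q]
    -- The inner swap sends `p` to `a`; the outer one moves the image of `q` to `c` without
    -- disturbing `a`.
    obtain ⟨b, hb⟩ := toPerm_surjective n (swap (swap p a q) c * swap p a)
    refine ⟨b, ?_⟩
    rw [hb]
    change (swap (swap p a q) c * swap p a) • s(p, q) = s(a, c)
    have hne : swap p a q ≠ a := by
      intro h
      rw [← swap_apply_left p a] at h
      exact hpq ((swap p a).injective h).symm
    rw [Sym2.perm_smul_mk, Perm.mul_apply, Perm.mul_apply, swap_apply_left, swap_apply_left,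
      swap_apply_of_ne_of_ne hne.symm hz]

/-- The unordered pairs of distinct points. -/
abbrev Edge (n : ℕ) : Type := {z : Sym2 (Fin n) // ¬ z.IsDiag}

/-- A braid carrying the first two strands to a given pair. -/
noncomputable def edgeBraid {n : ℕ} (hn : 0 < n - 1) (z : Edge n) : BraidGroup n :=
  (exists_perm_smul_genPair hn z.2).choose

theorem toPerm_edgeBraid {n : ℕ} (hn : 0 < n - 1) (z : Edge n) :
    toPerm n (edgeBraid hn z) • genPair ⟨0, hn⟩ = z :=
  (exists_perm_smul_genPair hn z.2).choose_spec

/-- The full twist of a pair of strands. -/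
noncomputable def edgeTwist {n : ℕ} (hn : 0 < n - 1) (z : Edge n) : BraidGroup n :=
  edgeBraid hn z * gen ⟨0, hn⟩ ^ 2 * (edgeBraid hn z)⁻¹

theorem crossing_edgeTwist {n : ℕ} (hn : 0 < n - 1) (z : Edge n) :
    crossing n (edgeTwist hn z) =
      SemidirectProduct.inl (Pi.mulSingle (z : Sym2 (Fin n)) (Multiplicative.ofAdd 2)) := by
  rw [edgeTwist, crossing_conj_gen_sq, toPerm_edgeBraid]

theorem commute_zpowersHom_edgeTwist {n : ℕ} (hn : 0 < n - 1) : Pairwise fun z y : Edge n =>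
    ∀ k l : Multiplicative ℤ, Commute (zpowersHom _ (modComm n (edgeTwist hn z)) k)
      (zpowersHom _ (modComm n (edgeTwist hn y)) l) := by
  intro z y _ k l
  exact (modComm_commute (conj_gen_sq_mem _ _) (conj_gen_sq_mem _ _)).zpow_zpow _ _

/-- The product of powers of the twists with given exponents. -/
noncomputable def twistHom {n : ℕ} (hn : 0 < n - 1) :
    (Edge n → Multiplicative ℤ) →* BraidModCommutator n :=
  MonoidHom.noncommPiCoprod (fun z => zpowersHom _ (modComm n (edgeTwist hn z)))
    (commute_zpowersHom_edgeTwist hn)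

theorem twistHom_mulSingle {n : ℕ} (hn : 0 < n - 1) (z : Edge n) (k : Multiplicative ℤ) :
    twistHom hn (Pi.mulSingle z k) = modComm n (edgeTwist hn z) ^ k.toAdd := by
  rw [twistHom, MonoidHom.noncommPiCoprod_mulSingle, zpowersHom_apply]

/-- All `σᵢ` are conjugate, so each normal generator of the pure braid group becomes a single twist
in the quotient. -/
theorem modComm_mem_range_twistHom {n : ℕ} (hn : 0 < n - 1) {x : BraidGroup n}
    (hx : x ∈ PureBraidGroup n) : modComm n x ∈ (twistHom hn).range := by
  rw [pureBraidGroup_eq_normalClosure, Subgroup.normalClosure] at hx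
  refine (Subgroup.closure_le ((twistHom hn).range.comap (modComm n))).mpr ?_ hx
  intro y hy
  obtain ⟨_, ⟨i, rfl⟩, hconj⟩ := Group.mem_conjugatesOfSet_iff.mp hy
  obtain ⟨b, rfl⟩ := isConj_iff.mp hconj
  obtain ⟨c, hc⟩ := exists_gen_eq_conj hn i
  have hz : ¬ (toPerm n (b * c) • genPair ⟨0, hn⟩).IsDiag := by
    rw [Sym2.isDiag_perm_smul, genPair]
    simp
  refine ⟨Pi.mulSingle ⟨_, hz⟩ (Multiplicative.ofAdd 1), ?_⟩
  rw [twistHom_mulSingle, toAdd_ofAdd, zpow_one, edgeTwist,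
    modComm_conj_eq hn (toPerm_edgeBraid hn ⟨_, hz⟩)]
  beta_reduce
  rw [hc, conj_pow]
  congr 1
  group

/-- The linking-number homomorphism on the quotient of the braid group. -/
def crossingBar (n : ℕ) : BraidModCommutator n →* PairWreath n :=
  QuotientGroup.lift _ (crossing n) (by
    rw [Subgroup.commutator_le]
    intro x hx y hy
    have h : ∀ x ∈ PureBraidGroup n,
        crossing n x = SemidirectProduct.inl (crossing n x).left := fun x hx =>
      SemidirectProduct.ext rfl (by rw [crossing_right]; exact hx)
    rw [MonoidHom.mem_ker, map_commutatorElement, commutatorElement_eq_one_iff_mul_comm,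
      h x hx, h y hy, ← map_mul, mul_comm, map_mul])

@[simp]
theorem crossingBar_modComm {n : ℕ} (b : BraidGroup n) :
    crossingBar n (modComm n b) = crossing n b := rfl

/-- Doubling of functions on edges, extended by zero to the diagonal. -/
def doubleExtend (n : ℕ) : (Edge n → Multiplicative ℤ) →* (Sym2 (Fin n) → Multiplicative ℤ) where
  toFun y z := if h : z.IsDiag then 1 else y ⟨z, h⟩ ^ 2
  map_one' := by ext z; simp
  map_mul' x y := by
    ext z
    by_cases h : z.IsDiag <;> simp [h, mul_pow]

theorem doubleExtend_injective (n : ℕ) : Function.Injective (doubleExtend n) := by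
  intro x y h
  ext ⟨z, hz⟩
  have := congrFun h z
  simp only [doubleExtend, MonoidHom.coe_mk, OneHom.coe_mk, dif_neg hz] at this
  have h2 := congrArg Multiplicative.toAdd this
  simp only [toAdd_pow] at h2
  simpa using h2

theorem crossingBar_twistHom {n : ℕ} (hn : 0 < n - 1) (y : Edge n → Multiplicative ℤ) :
    crossingBar n (twistHom hn y) = SemidirectProduct.inl (doubleExtend n y) := by
  suffices (crossingBar n).comp (twistHom hn) = SemidirectProduct.inl.comp (doubleExtend n) from
    DFunLike.congr_fun this y
  refine MonoidHom.pi_ext fun z k => ?_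
  rw [MonoidHom.comp_apply, MonoidHom.comp_apply, twistHom_mulSingle, map_zpow,
    crossingBar_modComm, crossing_edgeTwist, ← map_zpow]
  congr 1
  ext y
  by_cases hy : y = z
  · subst hy
    simp [doubleExtend, z.2, mul_comm]
  · by_cases hd : y.IsDiag
    · simp [doubleExtend, hd, hy]
    · have : (⟨y, hd⟩ : Edge n) ≠ z := fun h => hy (congrArg Subtype.val h)
      simp [doubleExtend, hd, hy, this]

/-- A kernel element is pure, hence a product of twists with exponents `y`; its crossing function is
`2 y`, so `y = 0`. -/
theorem crossingBar_injective {n : ℕ} (hn : 0 < n - 1) : Function.Injective (crossingBar n) := by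
  rw [injective_iff_map_eq_one]
  intro a ha
  obtain ⟨x, rfl⟩ := QuotientGroup.mk'_surjective _ a
  change crossing n x = 1 at ha
  obtain ⟨y, hy⟩ := modComm_mem_range_twistHom hn (x := x) (by
    rw [MonoidHom.mem_ker, ← crossing_right, ha, SemidirectProduct.one_right])
  change modComm n x = 1
  have h1 : crossingBar n (modComm n x) = 1 := ha
  rw [← hy, crossingBar_twistHom] at h1
  have h2 := SemidirectProduct.inl_injective (h1.trans (map_one _).symm)
  rw [← hy, doubleExtend_injective n (h2.trans (map_one _).symm), map_one]

end BraidGroup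

/-! ### Lifting subgroups of odd order -/

namespace BraidGroup

/-- Values are written multiplicatively, so squares are the even functions. With the next lemma,
this reduces membership in the image to parity. -/
theorem inl_sq_mem_range_crossingBar {n : ℕ} (hn : 0 < n - 1) {y : Sym2 (Fin n) → Multiplicative ℤ}
    (hy : ∀ z : Sym2 (Fin n), z.IsDiag → y z = 1) :
    (SemidirectProduct.inl (y ^ 2) : PairWreath n) ∈ (crossingBar n).range := by
  refine ⟨twistHom hn fun z => y z, ?_⟩
  rw [crossingBar_twistHom]
  congr 1
  ext z
  by_cases h : z.IsDiag <;> simp [doubleExtend, h, hy]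

theorem exists_crossing_left_eq_sq {n : ℕ} (hn : 0 < n - 1) {x : BraidGroup n}
    (hx : x ∈ PureBraidGroup n) : ∃ y : Sym2 (Fin n) → Multiplicative ℤ,
      (∀ z : Sym2 (Fin n), z.IsDiag → y z = 1) ∧ (crossing n x).left = y ^ 2 := by
  obtain ⟨y, hy⟩ := modComm_mem_range_twistHom hn hx
  have h := congrArg (fun a => (crossingBar n a).left) hy
  rw [crossingBar_twistHom, crossingBar_modComm, SemidirectProduct.left_inl] at h
  refine ⟨fun z => if hz : z.IsDiag then 1 else y ⟨z, hz⟩, fun z hz => dif_pos hz, ?_⟩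
  rw [← h]
  ext z
  by_cases hz : z.IsDiag <;> simp [doubleExtend, hz]

/-- Two braids with the same permutation have crossing numbers of the same parity. -/
theorem exists_crossing_left_eq_mul_sq {n : ℕ} (hn : 0 < n - 1) {a b : BraidGroup n}
    (hab : toPerm n a = toPerm n b) : ∃ y : Sym2 (Fin n) → Multiplicative ℤ,
      (∀ z : Sym2 (Fin n), z.IsDiag → y z = 1) ∧
        (crossing n a).left = y ^ 2 * (crossing n b).left := by
  obtain ⟨y, hy, hxy⟩ := exists_crossing_left_eq_sq hn (x := a * b⁻¹) (by
    rw [MonoidHom.mem_ker, map_mul, map_inv, hab, mul_inv_cancel])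
  refine ⟨y, hy, ?_⟩
  have h : (crossing n (a * b⁻¹ * b)).left = y ^ 2 * (crossing n b).left := by
    rw [map_mul, SemidirectProduct.mul_left, hxy, crossing_right, map_mul, map_inv, hab,
      mul_inv_cancel, map_one, MulAut.one_apply]
  rwa [inv_mul_cancel_right] at h

/-- Every subgroup of odd order of the symmetric group lifts to the quotient of the braid group by
the commutator subgroup of the pure braid group. -/
theorem exists_mulEquiv_of_odd_card {n : ℕ} (hn : 0 < n - 1) (K : Subgroup (Perm (Fin n)))
    (hK : Odd (Nat.card K)) :
    ∃ G : Subgroup (BraidModCommutator n), Nonempty (K ≃* G) := by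
  classical
  choose b hb using toPerm_surjective n
  let u : Perm (Fin n) → (Sym2 (Fin n) → Multiplicative ℤ) := fun g => (crossing n (b g)).left
  let c : Sym2 (Fin n) → Multiplicative ℤ := ∏ g : K, u g
  -- The candidate splitting: the standard copy of the symmetric group conjugated by `c`.
  let τ : Perm (Fin n) →* PairWreath n :=
    (MulAut.conj (SemidirectProduct.inl c : PairWreath n)).toMonoidHom.comp SemidirectProduct.inr
  have hτ : Function.Injective τ :=
    (MulAut.conj (SemidirectProduct.inl c : PairWreath n)).injective.comp
      SemidirectProduct.inr_injective
  have hu : ∀ g z, Sym2.IsDiag z → u g z = 1 := fun g z hz => crossing_left_of_isDiag _ hz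
  have hcocycle : ∀ h g : Perm (Fin n), ∃ y : Sym2 (Fin n) → Multiplicative ℤ,
      (∀ z : Sym2 (Fin n), z.IsDiag → y z = 1) ∧
        u (h * g) = y ^ 2 * (u h * mulAutArrow h (u g)) := by
    intro h g
    obtain ⟨y, hy, hyu⟩ := exists_crossing_left_eq_mul_sq hn (a := b (h * g)) (b := b h * b g)
      (by rw [map_mul, hb, hb, hb])
    refine ⟨y, hy, hyu.trans ?_⟩
    rw [map_mul, SemidirectProduct.mul_left, crossing_right, hb]
  choose q hq hqu using hcocycle
  obtain ⟨k, hk⟩ := hK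
  rw [Nat.card_eq_fintype_card] at hk
  have hrange : K.map τ ≤ (crossingBar n).range := by
    rintro _ ⟨h, hh, rfl⟩
    -- Reindex by `g ↦ h * g` and apply the cocycle identity; the constant factor `u h` occurs `|K|
    -- = 2 k + 1` times.
    have hsum : c = (∏ g : K, q h g) ^ 2 * (u h ^ (2 * k + 1) * mulAutArrow h c) := by
      have h1 : c = ∏ g : K, u (h * g) :=
        (Fintype.prod_equiv (Equiv.mulLeft (⟨h, hh⟩ : K)) _ _ fun g => rfl).symm
      conv_lhs => rw [h1, Finset.prod_congr rfl fun (g : K) _ => hqu h g]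
      rw [Finset.prod_mul_distrib, Finset.prod_mul_distrib, Finset.prod_pow, Finset.prod_const,
        Finset.card_univ, hk, map_prod]
    -- The odd power of `u h` leaves one `u h`, supplied by the braid `b h`; everything else is a
    -- square.
    have hτh : τ h = SemidirectProduct.inl (((∏ g : K, q h g) * u h ^ k) ^ 2) *
        crossing n (b h) := by
      refine SemidirectProduct.ext ?_ ?_
      · have : (τ h).left = c * (mulAutArrow h c)⁻¹ := by simp [τ]
        rw [this, SemidirectProduct.mul_left, SemidirectProduct.left_inl,
          SemidirectProduct.right_inl, map_one, MulAut.one_apply, mul_inv_eq_iff_eq_mul]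
        conv_lhs => rw [hsum]
        change _ = _ * u h * _
        rw [pow_succ (u h), pow_mul', mul_pow]
        simp only [mul_assoc]
      · rw [SemidirectProduct.mul_right, SemidirectProduct.right_inl, one_mul, crossing_right, hb]
        simp [τ]
    rw [hτh]
    refine mul_mem (inl_sq_mem_range_crossingBar hn fun z hz => ?_) ⟨modComm n (b h), rfl⟩
    rw [Pi.mul_apply, Pi.pow_apply, hu h z hz, one_pow, mul_one, Finset.prod_apply]
    exact Finset.prod_eq_one fun g _ => hq h g z hz
  refine ⟨(K.map τ).comap (crossingBar n), ⟨(K.equivMapOfInjective τ hτ).trans ?_⟩⟩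
  refine ((((K.map τ).comap (crossingBar n)).equivMapOfInjective _
    (crossingBar_injective hn)).trans (MulEquiv.subgroupCongr ?_)).symm
  exact Subgroup.map_comap_eq_self hrange

end BraidGroup

/-! ### Affine groups as Frobenius groups -/

/-- The group of affine permutations `x ↦ a x + b` of a commutative ring whose slope `a` lies in a
given group of units. -/
def affinePerm {R : Type*} [CommRing R] (Q : Subgroup Rˣ) : Subgroup (Perm R) where
  carrier := {g | ∃ a ∈ Q, ∃ b : R, ∀ x, g x = a * x + b}
  one_mem' := ⟨1, one_mem _, 0, by simp⟩
  mul_mem' := by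
    rintro g h ⟨a, ha, b, hg⟩ ⟨c, hc, d, hh⟩
    refine ⟨a * c, mul_mem ha hc, a * d + b, fun x => ?_⟩
    rw [Perm.mul_apply, hh, hg]
    push_cast
    ring
  inv_mem' := by
    rintro g ⟨a, ha, b, hg⟩
    refine ⟨a⁻¹, inv_mem ha, -(a⁻¹ * b), fun x => ?_⟩
    rw [Perm.inv_eq_iff_eq, hg, mul_add, Units.mul_inv_cancel_left, mul_neg,
      Units.mul_inv_cancel_left, neg_add_cancel_right]

section affinePerm

variable {R : Type*} [CommRing R] (Q : Subgroup Rˣ)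

/-- The affine permutation `x ↦ a x + b`. -/
def affinePermMk (a : Q) (b : R) : affinePerm Q :=
  ⟨(Units.mulLeft (a : Rˣ)).trans (Equiv.addRight b), a, a.2, b, fun _ => rfl⟩

@[simp]
theorem affinePermMk_apply (a : Q) (b x : R) :
    (affinePermMk Q a b : Perm R) x = (a : Rˣ) * x + b := rfl

theorem card_affinePerm : Nat.card (affinePerm Q) = Nat.card R * Nat.card Q := by
  rw [mul_comm, ← Nat.card_prod]
  refine (Nat.card_eq_of_bijective (fun x : Q × R => affinePermMk Q x.1 x.2) ⟨?_, ?_⟩).symm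
  · rintro ⟨a, b⟩ ⟨c, d⟩ h
    have h' : ∀ x : R, (a : Rˣ) * x + b = (c : Rˣ) * x + d := fun x =>
      DFunLike.congr_fun (congrArg Subtype.val h) x
    have h0 : b = d := by simpa using h' 0
    have h1 : ((a : Rˣ) : R) = (c : Rˣ) := by simpa [h0] using h' 1
    rw [h0, Subtype.ext (Units.ext h1)]
  · rintro ⟨g, a, ha, b, hg⟩
    exact ⟨(⟨a, ha⟩, b), Subtype.ext (Equiv.ext fun x => (hg x).symm)⟩

theorem affinePerm_eq_one_of_fixed [IsDomain R] {g : Perm R} (hg : g ∈ affinePerm Q) {x y : R}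
    (hxy : x ≠ y) (hx : g x = x) (hy : g y = y) : g = 1 := by
  obtain ⟨a, -, b, h⟩ := hg
  rw [h] at hx hy
  have h1 : ((a : R) - 1) * (x - y) = 0 := by linear_combination hx - hy
  rcases mul_eq_zero.mp h1 with h2 | h2
  · have ha : (a : R) = 1 := sub_eq_zero.mp h2
    have hb : b = 0 := by rw [ha] at hx; linear_combination hx
    refine Equiv.ext fun z => ?_
    rw [h, ha, hb, one_mul, add_zero, Perm.one_apply]
  · exact absurd (sub_eq_zero.mp h2) hxy

/-- The complement is the stabilizer of `0`. If `x` and `g * x * g⁻¹` both fix `0`, then `x` fixes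
`0` and `g⁻¹ 0 ≠ 0`, and an affine map with two fixed points is trivial. -/
theorem isFrobeniusGroup_affinePerm [IsDomain R] (hQ : Q ≠ ⊥) :
    IsFrobeniusGroup (affinePerm Q) := by
  obtain ⟨a, ha⟩ := Subgroup.ne_bot_iff_exists_ne_one.mp hQ
  refine ⟨(MulAction.stabilizer (Perm R) (0 : R)).subgroupOf (affinePerm Q), ?_, ?_, ?_⟩
  · rw [Subgroup.ne_bot_iff_exists_ne_one]
    refine ⟨⟨affinePermMk Q a 0, ?_⟩, fun h => ha ?_⟩
    · simp [Subgroup.mem_subgroupOf]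
    · have h1 : (affinePermMk Q a 0 : Perm R) = 1 :=
        congrArg (fun g => ((g : affinePerm Q) : Perm R)) (congrArg Subtype.val h)
      have h2 := DFunLike.congr_fun h1 1
      exact Subtype.ext (Units.ext (by simpa using h2))
  · intro h
    have h1 : affinePermMk Q 1 1 ∈
        (MulAction.stabilizer (Perm R) (0 : R)).subgroupOf (affinePerm Q) := h ▸ trivial
    simp [Subgroup.mem_subgroupOf] at h1
  · intro g hg x hx hgx
    rw [Subgroup.mem_subgroupOf, MulAction.mem_stabilizer_iff, Perm.smul_def] at hg hx hgx
    have hne : (g : Perm R)⁻¹ 0 ≠ 0 := fun h => hg (by rw [Perm.inv_eq_iff_eq] at h; exact h.symm)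
    refine Subtype.ext (affinePerm_eq_one_of_fixed Q x.2 hne ?_ hx)
    rw [Subgroup.coe_mul, Subgroup.coe_mul, Subgroup.coe_inv, Perm.mul_apply, Perm.mul_apply] at hgx
    rw [Perm.eq_inv_iff_eq, hgx]

/-- At `0`, the two composites of `x ↦ a x` and `x ↦ x + 1` give `a` and `1`. -/
theorem exists_mul_ne_mul_affinePerm (hQ : Q ≠ ⊥) :
    ∃ x y : affinePerm Q, x * y ≠ y * x := by
  obtain ⟨a, ha⟩ := Subgroup.ne_bot_iff_exists_ne_one.mp hQ
  refine ⟨affinePermMk Q a 0, affinePermMk Q 1 1, fun h => ha ?_⟩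
  have h1 := DFunLike.congr_fun (congrArg Subtype.val h) 0
  rw [Subgroup.coe_mul, Subgroup.coe_mul, Perm.mul_apply, Perm.mul_apply] at h1
  simp only [affinePermMk_apply] at h1
  exact Subtype.ext (Units.ext (by simpa using h1))

end affinePerm

/-! ### Primes congruent to 3 modulo 4 -/

theorem card_units_sq {p : ℕ} [Fact p.Prime] (hp : p % 2 = 1) :
    Nat.card (powMonoidHom 2 : (ZMod p)ˣ →* (ZMod p)ˣ).range = (p - 1) / 2 := by
  rw [IsCyclic.card_powMonoidHom_range, Nat.card_eq_fintype_card, ZMod.card_units,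
    Nat.gcd_eq_right (Nat.dvd_of_mod_eq_zero (by omega))]

theorem IsFrobeniusGroup.of_mulEquiv {G H : Type*} [Group G] [Group H] (e : G ≃* H)
    (hG : IsFrobeniusGroup G) : IsFrobeniusGroup H := by
  obtain ⟨K, h1, h2, h3⟩ := hG
  refine ⟨K.comap e.symm.toMonoidHom, fun h => h1 ?_, fun h => h2 ?_, fun g hg x hx hgx => ?_⟩
  · rw [eq_bot_iff]
    intro x hx
    have : e x ∈ K.comap e.symm.toMonoidHom := by simpa using hx
    rw [h] at this
    simpa using this
  · rw [eq_top_iff]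
    intro x _
    have : e x ∈ K.comap e.symm.toMonoidHom := h ▸ trivial
    simpa using this
  · have := h3 (e.symm g) hg (e.symm x) hx (by simpa using hgx)
    simpa using this

theorem exists_mul_ne_mul_of_mulEquiv {G H : Type*} [Group G] [Group H] (e : G ≃* H)
    (hG : ∃ x y : G, x * y ≠ y * x) : ∃ x y : H, x * y ≠ y * x := by
  obtain ⟨x, y, h⟩ := hG
  exact ⟨e x, e y, fun h' => h (e.injective (by rw [map_mul, map_mul, h']))⟩

/-- For a prime `p ≡ 3 (mod 4)`, the group of affine maps of `ℤ/p` with square slope embeds in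
`B_p / (P_p, P_p)`. -/
theorem exists_affinePerm_mulEquiv {p : ℕ} [Fact p.Prime] (hp : p % 4 = 3) :
    ∃ G : Subgroup (BraidModCommutator p),
      Nonempty (affinePerm (powMonoidHom 2 : (ZMod p)ˣ →* (ZMod p)ˣ).range ≃* G) := by
  set Q := (powMonoidHom 2 : (ZMod p)ˣ →* (ZMod p)ˣ).range
  let e : Perm (ZMod p) ≃* Perm (Fin p) := (ZMod.finEquiv p).symm.toEquiv.permCongrHom
  have e' : affinePerm Q ≃* (affinePerm Q).map e.toMonoidHom :=
    (affinePerm Q).equivMapOfInjective _ e.injective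
  have hodd : Odd (Nat.card ((affinePerm Q).map e.toMonoidHom)) := by
    rw [← Nat.card_congr e'.toEquiv, card_affinePerm, Nat.card_zmod, card_units_sq (by omega),
      Nat.odd_mul, Nat.odd_iff, Nat.odd_iff]
    omega
  obtain ⟨G, ⟨f⟩⟩ := BraidGroup.exists_mulEquiv_of_odd_card (by omega) _ hodd
  exact ⟨G, ⟨e'.trans f⟩⟩

theorem exists_subgroup_of_prime {p : ℕ} (hpp : p.Prime) (hp : p % 4 = 3) :
    ∃ G : Subgroup (BraidModCommutator p),
      Nat.card G = p * (p - 1) / 2 ∧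
      (3 < p → IsFrobeniusGroup G ∧ ∃ x y : G, x * y ≠ y * x) := by
  have := Fact.mk hpp
  obtain ⟨G, ⟨f⟩⟩ := exists_affinePerm_mulEquiv hp
  refine ⟨G, ?_, fun h3 => ?_⟩
  · rw [← Nat.card_congr f.toEquiv, card_affinePerm, Nat.card_zmod, card_units_sq (by omega),
      Nat.mul_div_assoc _ (Nat.dvd_of_mod_eq_zero (by omega))]
  -- For `p > 3` there are `(p - 1) / 2 > 1` nonzero squares.
  · have hQ : (powMonoidHom 2 : (ZMod p)ˣ →* (ZMod p)ˣ).range ≠ ⊥ := by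
      intro h
      have hc := card_units_sq (p := p) (by omega)
      rw [h, Subgroup.card_bot] at hc
      omega
    exact ⟨(isFrobeniusGroup_affinePerm _ hQ).of_mulEquiv f,
      exists_mul_ne_mul_of_mulEquiv f (exists_mul_ne_mul_affinePerm _ hQ)⟩

theorem corollary3p11 :
    (∀ p : ℕ, p.Prime → p % 4 = 3 →
      ∃ G : Subgroup (BraidModCommutator p),
        Nat.card G = p * (p - 1) / 2 ∧
        (3 < p → IsFrobeniusGroup G ∧ ∃ x y : G, x * y ≠ y * x)) ∧
    (∃ G : Subgroup (BraidModCommutator 7),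
      Nat.card G = 21 ∧ ∃ x y : G, x * y ≠ y * x) := by
  refine ⟨fun p hpp hp => exists_subgroup_of_prime hpp hp, ?_⟩
  obtain ⟨G, hcard, hG⟩ := exists_subgroup_of_prime (p := 7) (by norm_num) (by norm_num)
  exact ⟨G, hcard, (hG (by norm_num)).2⟩
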